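/- Let $L=[\gamma,\delta]$ with $\gamma<\delta$ real, regarded as a subset of $\mathbb{R}\subset\mathbb{C}$, and let $k\in\{0,1,2,\dots\}\cup\{\infty\}$. Let $C^k(L)$ be the space of $k$ times continuously differentiable functions $u:L\to\mathbb{C}$ (one-sided derivatives at the end points; infinitely differentiable functions if $k=\infty$) with the topology defined by the seminorms $\sup_{x\in L}|u^{(l)}(x)|$, $l\in\mathbb{N}$, $0\le l\le k$. Write $D(z_0,r)$ for the open disc of centre $z_0$ and radius $r$ in $\mathbb{C}$. Let $U_2(L,k)$ be the set of all $u\in C^k(L)$ for which there are no $z_0\in L$, $r>0$ and continuous function $\lambda:L\cup\Omega\to\mathbb{C}$, where $\Omega=D(z_0,r)\cap\{\operatorname{Im} z>0\}$, such that $\lambda$ is holomorphic on $\Omega$ and $\lambda=u$ on $D(z_0,r)\cap L$. Let $U_3(L,k)$ be defined in the same way with $\{\operatorname{Im} z<0\}$ in place of $\{\operatorname{Im} z>0\}$. Let $U_4(L,k)$ be the set of all $u\in C^k(L)$ that have neither an extension of the first kind nor one of the second kind, at any $z_0\in L$ and for any $r>0$. Let $U_5(L,k)$ be the set of all $u\in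 C^k(L)$ for which there are no $z_0\in L$, $r>0$ and holomorphic $f:D(z_0,r)\to\mathbb{C}$ with $f=u$ on $D(z_0,r)\cap L$. Then each of the sets $U_2(L,k)$, $U_3(L,k)$, $U_4(L,k)$ and $U_5(L,k)$ is dense and $G_\delta$ in $C^k(L)$. In particular, the set of all $u\in C^\infty([0,1])$ that are real analytic at no point of $[0,1]$ is a dense $G_\delta$ subset of $C^\infty([0,1])$; here $u$ is real analytic at $x_0\in[0,1]$ if there are $\varepsilon>0$ and a power series $\sum_{n\ge 0} a_n(x-x_0)^n$ with complex coefficients that converges to $u(x)$ for all $x\in[0,1]$ with $|x-x_0|<\varepsilon$. -/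

import Mathlib

open Set Metric Topology

noncomputable section

/-- The extension by zero to `ℝ` of a function on `[γ, δ]`. It only serves to speak of
one-sided notions relative to `[γ, δ]`, which do not see the values outside `[γ, δ]`. -/
def extendZero {γ δ : ℝ} (u : Icc γ δ → ℂ) : ℝ → ℂ :=
  Function.extend Subtype.val u 0

theorem extendZero_coe {γ δ : ℝ} (u : Icc γ δ → ℂ) (x : Icc γ δ) :
    extendZero u (x : ℝ) = u x :=
  Subtype.val_injective.extend_apply u 0 x

theorem extendZero_add {γ δ : ℝ} (u v : Icc γ δ → ℂ) :
    extendZero (u + v) = extendZero u + extendZero v := by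
  have h := Function.extend_add (Subtype.val : Icc γ δ → ℝ) u v (0 : ℝ → ℂ) 0
  rw [add_zero] at h
  exact h

theorem extendZero_smul {γ δ : ℝ} (c : ℂ) (u : Icc γ δ → ℂ) :
    extendZero (c • u) = c • extendZero u := by
  have h := Function.extend_smul c (Subtype.val : Icc γ δ → ℝ) u (0 : ℝ → ℂ)
  rw [smul_zero] at h
  exact h

/-- The complex-valued functions on `[γ, δ]` that are `k` times continuously differentiable
(one-sided derivatives at the end points), as a space of functions without topology. -/
def ckSubmodule (γ δ : ℝ) (k : ℕ∞) : Submodule ℂ (Icc γ δ → ℂ) where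
  carrier := {u | ContDiffOn ℝ k (extendZero u) (Icc γ δ)}
  add_mem' {u v} hu hv := by
    simp only [mem_ofPred_eq] at hu hv ⊢
    rw [extendZero_add]
    exact hu.add hv
  zero_mem' := by
    have h : extendZero (0 : Icc γ δ → ℂ) = 0 := by
      simpa using extendZero_smul (0 : ℂ) (0 : Icc γ δ → ℂ)
    simp only [mem_ofPred_eq]
    rw [h]
    exact contDiffOn_const
  smul_mem' c u hu := by
    simp only [mem_ofPred_eq] at hu ⊢
    rw [extendZero_smul]
    exact hu.const_smul c

/-- The space `C^k([γ, δ])`, `k = 0, 1, 2, …, ∞`, of complex-valued functions. It is a type of its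
own, so that it does not carry the topology of pointwise convergence. -/
def CkSpace {γ δ : ℝ} (_h : γ < δ) (k : ℕ∞) : Type :=
  ckSubmodule γ δ k

namespace CkSpace

variable {γ δ : ℝ} {h : γ < δ} {k : ℕ∞}

instance : AddCommGroup (CkSpace h k) := inferInstanceAs (AddCommGroup (ckSubmodule γ δ k))

instance : Module ℂ (CkSpace h k) := inferInstanceAs (Module ℂ (ckSubmodule γ δ k))

/-- The function on `[γ, δ]` underlying an element of `C^k([γ, δ])`. -/
def toFun (u : CkSpace h k) : Icc γ δ → ℂ := Subtype.val u

instance : CoeFun (CkSpace h k) (fun _ => Icc γ δ → ℂ) := ⟨toFun⟩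

theorem contDiffOn (u : CkSpace h k) : ContDiffOn ℝ k (extendZero u) (Icc γ δ) :=
  Subtype.property u

/-- The `l`-th derivative, `l ≤ k`, as a linear map from `C^k([γ, δ])` to the Banach space of
continuous functions on `[γ, δ]` with the supremum norm. -/
def derivMap (h : γ < δ) (k : ℕ∞) (l : ℕ) (hl : (l : ℕ∞) ≤ k) :
    CkSpace h k →ₗ[ℂ] C(Icc γ δ, ℂ) where
  toFun u :=
    { toFun := fun x => iteratedDerivWithin l (extendZero u) (Icc γ δ) x
      continuous_toFun := by
        have hc := u.contDiffOn.continuousOn_iteratedDerivWithin (m := l)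
          (by exact_mod_cast hl) (uniqueDiffOn_Icc h)
        exact hc.comp_continuous continuous_subtype_val (fun x => x.2) }
  map_add' u v := by
    ext x
    have e : extendZero (u + v : CkSpace h k) = extendZero u + extendZero v :=
      extendZero_add _ _
    change iteratedDerivWithin l (extendZero (u + v : CkSpace h k)) (Icc γ δ) x =
      iteratedDerivWithin l (extendZero u) (Icc γ δ) x +
        iteratedDerivWithin l (extendZero v) (Icc γ δ) x
    rw [e]
    exact iteratedDerivWithin_add x.2 (uniqueDiffOn_Icc h)
      ((u.contDiffOn.of_le (by exact_mod_cast hl)) x x.2)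
      ((v.contDiffOn.of_le (by exact_mod_cast hl)) x x.2)
  map_smul' c u := by
    ext x
    have e : extendZero (c • u : CkSpace h k) = c • extendZero u := extendZero_smul _ _
    change iteratedDerivWithin l (extendZero (c • u : CkSpace h k)) (Icc γ δ) x =
      c • iteratedDerivWithin l (extendZero u) (Icc γ δ) x
    rw [e]
    exact iteratedDerivWithin_const_smul x.2 (uniqueDiffOn_Icc h) c
      ((u.contDiffOn.of_le (by exact_mod_cast hl)) x x.2)

/-- The seminorms `u ↦ sup_{x ∈ [γ, δ]} |u^{(l)}(x)|`, `l ≤ k`. -/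
def seminorms (h : γ < δ) (k : ℕ∞) :
    SeminormFamily ℂ (CkSpace h k) {l : ℕ // (l : ℕ∞) ≤ k} :=
  fun l => (normSeminorm ℂ C(Icc γ δ, ℂ)).comp (derivMap h k l.1 l.2)

theorem seminorms_apply (l : {l : ℕ // (l : ℕ∞) ≤ k}) (u : CkSpace h k) :
    seminorms h k l u
      = ⨆ x : Icc γ δ, ‖iteratedDerivWithin (l : ℕ) (extendZero u) (Icc γ δ) x‖ :=
  ContinuousMap.norm_eq_iSup_norm (derivMap h k l.1 l.2 u)

instance : Nonempty {l : ℕ // (l : ℕ∞) ≤ k} := ⟨⟨0, by simp⟩⟩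

/-- The topology of `C^k([γ, δ])` defined by the seminorms `sup |u^{(l)}|`, `l ≤ k`. -/
instance : TopologicalSpace (CkSpace h k) := (seminorms h k).moduleFilterBasis.topology

theorem withSeminorms (h : γ < δ) (k : ℕ∞) : WithSeminorms (seminorms h k) := ⟨rfl⟩

end CkSpace

/-- The compact interval `[γ, δ]` as a subset of the complex plane. -/
def segmentC (γ δ : ℝ) : Set ℂ := (fun x : ℝ => (x : ℂ)) '' Icc γ δ

/-- The upper half disc `D(x₀, r) ∩ {Im z > 0}`. -/
def upperHalfDisc (x₀ r : ℝ) : Set ℂ := ball (x₀ : ℂ) r ∩ {z | 0 < z.im}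

/-- The lower half disc `D(x₀, r) ∩ {Im z < 0}`. -/
def lowerHalfDisc (x₀ r : ℝ) : Set ℂ := ball (x₀ : ℂ) r ∩ {z | z.im < 0}

section Classes

variable {γ δ : ℝ} {h : γ < δ} {k : ℕ∞}

/-- `u` extends to the upper half disc of centre `x₀` and radius `r`: there is a function that is
continuous on the union of the interval and the half disc, holomorphic on the half disc, and equal
to `u` on the part of the interval inside the disc. -/
def ExtendsAbove (u : CkSpace h k) (x₀ r : ℝ) : Prop :=
  ∃ f : ℂ → ℂ, ContinuousOn f (segmentC γ δ ∪ upperHalfDisc x₀ r) ∧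
    DifferentiableOn ℂ f (upperHalfDisc x₀ r) ∧
    ∀ x : Icc γ δ, ((x : ℝ) : ℂ) ∈ ball (x₀ : ℂ) r → f ((x : ℝ) : ℂ) = u x

/-- The same as `ExtendsAbove`, for the lower half disc. -/
def ExtendsBelow (u : CkSpace h k) (x₀ r : ℝ) : Prop :=
  ∃ f : ℂ → ℂ, ContinuousOn f (segmentC γ δ ∪ lowerHalfDisc x₀ r) ∧
    DifferentiableOn ℂ f (lowerHalfDisc x₀ r) ∧
    ∀ x : Icc γ δ, ((x : ℝ) : ℂ) ∈ ball (x₀ : ℂ) r → f ((x : ℝ) : ℂ) = u x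

/-- `u` coincides on the part of the interval inside the disc of centre `x₀` and radius `r` with
a function that is holomorphic on this disc. -/
def ExtendsToDisc (u : CkSpace h k) (x₀ r : ℝ) : Prop :=
  ∃ f : ℂ → ℂ, DifferentiableOn ℂ f (ball (x₀ : ℂ) r) ∧
    ∀ x : Icc γ δ, ((x : ℝ) : ℂ) ∈ ball (x₀ : ℂ) r → f ((x : ℝ) : ℂ) = u x

/-- The class `U₂([γ, δ], k)`. -/
def classU2 (h : γ < δ) (k : ℕ∞) : Set (CkSpace h k) :=
  {u | ¬ ∃ x₀ ∈ Icc γ δ, ∃ r > 0, ExtendsAbove u x₀ r}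

/-- The class `U₃([γ, δ], k)`. -/
def classU3 (h : γ < δ) (k : ℕ∞) : Set (CkSpace h k) :=
  {u | ¬ ∃ x₀ ∈ Icc γ δ, ∃ r > 0, ExtendsBelow u x₀ r}

/-- The class `U₄([γ, δ], k)`: neither an extension above nor an extension below exists. -/
def classU4 (h : γ < δ) (k : ℕ∞) : Set (CkSpace h k) :=
  {u | (¬ ∃ x₀ ∈ Icc γ δ, ∃ r > 0, ExtendsAbove u x₀ r) ∧
    ¬ ∃ x₀ ∈ Icc γ δ, ∃ r > 0, ExtendsBelow u x₀ r}

/-- The class `U₅([γ, δ], k)`. -/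
def classU5 (h : γ < δ) (k : ℕ∞) : Set (CkSpace h k) :=
  {u | ¬ ∃ x₀ ∈ Icc γ δ, ∃ r > 0, ExtendsToDisc u x₀ r}

/-- The functions in `C^k([γ, δ])` that are real analytic at no point of `[γ, δ]`: around no
`x₀ ∈ [γ, δ]` they are, on `[γ, δ]`, the sum of a convergent power series in `x - x₀`. -/
def nowhereAnalytic (h : γ < δ) (k : ℕ∞) : Set (CkSpace h k) :=
  {u | ∀ x₀ ∈ Icc γ δ, ¬ AnalyticWithinAt ℝ (extendZero u) (Icc γ δ) x₀}

end Classes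

end

/-!
By the maximum principle, a bounded holomorphic function on a half disc that is small on the
diameter is small on the concentric half disc of one eighth of the radius. Hence the functions with
an extension bounded by `M` on a given half disc have, in the closure, only functions that still
extend to the smaller half disc: a uniform limit on the diameter forces uniform convergence of the
extensions there. Rational centres and radii and integral bounds suffice, so the functions with an
extension form a countable union of closed sets. Each of these closed sets lies in a linear
subspace, which is proper because a smooth function that vanishes on one side of the centre but not
on the other has no extension, and therefore has empty interior. Baire's theorem applies to
`C^k([γ, δ])`, as the derivatives embed it as a closed subspace of a countable product of Banach
spaces. The discs of `U₅` are treated as pairs of half discs.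
-/

noncomputable section

open Filter ComplexConjugate

theorem dense_and_isGδ_compl_iUnion_of_submodule {𝕜 E ι : Type*} [NontriviallyNormedField 𝕜]
    [AddCommGroup E] [Module 𝕜 E] [TopologicalSpace E] [ContinuousAdd E] [ContinuousSMul 𝕜 E]
    [BaireSpace E] [Countable ι] {A : ι → Set E} {W : ι → Submodule 𝕜 E}
    (hAW : ∀ i, closure (A i) ⊆ W i) (hWA : ∀ i, (W i : Set E) ⊆ ⋃ j, A j)
    (hW : ∀ i, W i ≠ ⊤) : Dense (⋃ i, A i)ᶜ ∧ IsGδ (⋃ i, A i)ᶜ := by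
  have hA : (⋃ i, A i)ᶜ = ⋂ i, (closure (A i))ᶜ := by
    rw [← compl_iUnion, (iUnion_mono fun i => subset_closure).antisymm
      (iUnion_subset fun i => (hAW i).trans (hWA i))]
  have hopen (i : ι) : IsOpen (closure (A i))ᶜ := isClosed_closure.isOpen_compl
  rw [hA]
  refine ⟨dense_iInter_of_isOpen hopen fun i => ?_, .iInter_of_isOpen hopen⟩
  rw [← interior_eq_empty_iff_dense_compl, ← not_nonempty_iff_eq_empty]
  exact fun hne => hW i ((W i).eq_top_of_nonempty_interior' (hne.mono (interior_mono (hAW i))))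

theorem exists_tendstoUniformlyOn_of_uniformCauchySeqOn {α β ι : Type*} [UniformSpace β]
    [CompleteSpace β] [Nonempty β] {p : Filter ι} [p.NeBot] {F : ι → α → β} {s : Set α}
    (hF : UniformCauchySeqOn F p s) : ∃ f, TendstoUniformlyOn F f p s := by
  have hlim : ∀ x ∈ s, ∃ y, Tendsto (F · x) p (𝓝 y) := fun x hx =>
    cauchy_map_iff_exists_tendsto.1 (hF.cauchy_map hx)
  choose! f hf using hlim
  exact ⟨f, hF.tendstoUniformlyOn_of_tendsto hf⟩

theorem closure_inter_of_convex {E : Type*} [AddCommGroup E] [Module ℝ E] [TopologicalSpace E]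
    [IsTopologicalAddGroup E] [ContinuousSMul ℝ E] {s t : Set E} (hs : Convex ℝ s)
    (ht : Convex ℝ t) (hso : IsOpen s) (hto : IsOpen t) (hst : (s ∩ t).Nonempty) :
    closure (s ∩ t) = closure s ∩ closure t := by
  refine (closure_inter_subset_inter_closure s t).antisymm fun x ⟨hxs, hxt⟩ => ?_
  obtain ⟨y, hys, hyt⟩ := hst
  have hsub : openSegment ℝ x y ⊆ s ∩ t := subset_inter
    ((hs.openSegment_closure_interior_subset_interior hxs (hso.interior_eq.symm ▸ hys)).trans
      interior_subset)
    ((ht.openSegment_closure_interior_subset_interior hxt (hto.interior_eq.symm ▸ hyt)).trans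
      interior_subset)
  exact closure_mono hsub (segment_subset_closure_openSegment (left_mem_segment ℝ x y))

theorem dist_ofReal_ofReal (x y : ℝ) : dist (x : ℂ) y = |x - y| := by
  rw [Complex.dist_of_im_eq (by simp), Complex.ofReal_re, Complex.ofReal_re, Real.dist_eq]

/-- The qualitative form of the two-constants theorem for the pair `Ω`, `Ω'`: functions holomorphic
in `Ω` and continuous up to its boundary that obey a common bound on `Ω` are uniformly small on `Ω'`
once they are small at the real points of `closure Ω`. -/
def TwoConstants (Ω Ω' : Set ℂ) : Prop :=
  ∀ M : ℝ, ∀ η > 0, ∃ ε > 0, ∀ g : ℂ → ℂ, DiffContOnCl ℂ g Ω → (∀ z ∈ closure Ω, ‖g z‖ ≤ M) →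
    (∀ x : ℝ, (x : ℂ) ∈ closure Ω → ‖g x‖ ≤ ε) → ∀ z ∈ closure Ω', ‖g z‖ ≤ η

namespace TwoConstants

variable {Ω Ω' Λ Λ' : Set ℂ}

theorem of_closure_subset_union (hΩ : TwoConstants Ω Ω') (hΛ : TwoConstants Λ Λ') {U U' : Set ℂ}
    (hΩU : Ω ⊆ U) (hΛU : Λ ⊆ U) (hU' : closure U' ⊆ closure Ω' ∪ closure Λ') :
    TwoConstants U U' := by
  intro M η hη
  obtain ⟨ε₁, hε₁, h₁⟩ := hΩ M η hη
  obtain ⟨ε₂, hε₂, h₂⟩ := hΛ M η hη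
  refine ⟨min ε₁ ε₂, lt_min hε₁ hε₂, fun g hg hM hε z hz => ?_⟩
  rcases hU' hz with hz | hz
  · exact h₁ g (hg.mono hΩU) (fun w hw => hM w (closure_mono hΩU hw))
      (fun x hx => (hε x (closure_mono hΩU hx)).trans (min_le_left _ _)) z hz
  · exact h₂ g (hg.mono hΛU) (fun w hw => hM w (closure_mono hΛU hw))
      (fun x hx => (hε x (closure_mono hΛU hx)).trans (min_le_right _ _)) z hz

theorem preimage_conj (h : TwoConstants Ω Ω') (hΩ : IsOpen Ω) :
    TwoConstants (conj ⁻¹' Ω) (conj ⁻¹' Ω') := by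
  have hcl (s : Set ℂ) : closure (conj ⁻¹' s) = conj ⁻¹' closure s :=
    (Complex.conjCLE.toHomeomorph.preimage_closure s).symm
  intro M η hη
  obtain ⟨ε, hε, H⟩ := h M η hη
  refine ⟨ε, hε, fun g hg hM hgε z hz => ?_⟩
  rw [hcl] at hM hgε hz
  have hmaps : MapsTo conj (closure Ω) (closure (conj ⁻¹' Ω)) := fun w hw => by
    rwa [hcl, mem_preimage, Complex.conj_conj]
  have hgc : DiffContOnCl ℂ (fun w => conj (g (conj w))) Ω := by
    refine ⟨fun w hw => ?_, Complex.continuous_conj.comp_continuousOn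
      (hg.continuousOn.comp Complex.continuous_conj.continuousOn hmaps)⟩
    have hd := (hg.differentiableAt (hΩ.preimage Complex.continuous_conj)
      (x := conj w) (by rwa [mem_preimage, Complex.conj_conj])).conj_conj
    rw [Complex.conj_conj] at hd
    exact hd.differentiableWithinAt
  have hz' := H _ hgc (fun w hw => ?_) (fun x hx => ?_) (conj z) hz
  · rwa [RCLike.norm_conj, Complex.conj_conj] at hz'
  · rw [RCLike.norm_conj]
    exact hM _ (by rwa [mem_preimage, Complex.conj_conj])
  · rw [RCLike.norm_conj, Complex.conj_ofReal]
    exact hgε x (by rwa [mem_preimage, Complex.conj_ofReal])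

theorem eqOn_zero (h : TwoConstants Ω Ω') (hΩ : Bornology.IsBounded Ω) {g : ℂ → ℂ}
    (hg : DiffContOnCl ℂ g Ω) (hg0 : ∀ x : ℝ, (x : ℂ) ∈ closure Ω → g x = 0) :
    EqOn g 0 (closure Ω') := by
  intro z hz
  obtain ⟨M, hM⟩ := hΩ.isCompact_closure.exists_bound_of_continuousOn hg.continuousOn
  refine norm_le_zero_iff.1 (le_of_forall_pos_le_add fun η hη => ?_)
  obtain ⟨ε, hε, H⟩ := h M η hη
  rw [zero_add]
  exact H g hg hM (fun x hx => by rw [hg0 x hx, norm_zero]; exact hε.le) z hz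

theorem uniformCauchySeqOn (h : TwoConstants Ω Ω') {F : ℕ → ℂ → ℂ} {M : ℝ}
    (hF : ∀ n, DiffContOnCl ℂ (F n) Ω) (hM : ∀ n, ∀ z ∈ closure Ω, ‖F n z‖ ≤ M)
    (hu : UniformCauchySeqOn F atTop (closure Ω ∩ range ((↑) : ℝ → ℂ))) :
    UniformCauchySeqOn F atTop (closure Ω') := by
  rw [Metric.uniformCauchySeqOn_iff] at hu ⊢
  intro η hη
  obtain ⟨ε, hε, H⟩ := h (M + M) (η / 2) (half_pos hη)
  obtain ⟨N, hN⟩ := hu ε hε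
  refine ⟨N, fun m hm n hn z hz => ?_⟩
  rw [dist_eq_norm]
  refine (H (F m - F n) ((hF m).sub (hF n)) (fun w hw => ?_) (fun x hx => ?_) z hz).trans_lt
    (half_lt_self hη)
  · exact (norm_sub_le _ _).trans (add_le_add (hM m w hw) (hM n w hw))
  · rw [Pi.sub_apply, ← dist_eq_norm]
    exact (hN m hm n hn x ⟨hx, mem_range_self x⟩).le

end TwoConstants

section HalfDisc

variable {x₀ r : ℝ} {z : ℂ}

theorem dist_ofReal_sq (z : ℂ) (x₀ : ℝ) :
    dist z x₀ ^ 2 = (z.re - x₀) ^ 2 + z.im ^ 2 := by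
  rw [Complex.dist_eq_re_im, Real.sq_sqrt (by positivity), Complex.ofReal_re, Complex.ofReal_im,
    sub_zero]

theorem mem_closure_upperHalfDisc (hz : z ∈ closure (upperHalfDisc x₀ r)) :
    dist z x₀ ≤ r ∧ 0 ≤ z.im := by
  have h := closure_inter_subset_inter_closure _ _ hz
  rw [Complex.closure_setOfPred_lt_im] at h
  exact ⟨closure_ball_subset_closedBall h.1, h.2⟩

theorem mem_frontier_upperHalfDisc (hz : z ∈ frontier (upperHalfDisc x₀ r)) :
    z.im = 0 ∨ dist z x₀ = r := by
  rcases frontier_inter_subset _ _ hz with h | h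
  · exact Or.inr (frontier_ball_subset_sphere h.1)
  · exact Or.inl ((Complex.frontier_setOfPred_lt_im 0).subset h.2)

/-- An entire function that dominates the half disc of centre `x₀` and radius `r` near its centre,
since its modulus is at most `1` on the arc: it is the Gaussian of the top `x₀ + i r`. -/
def barrier (x₀ r N : ℝ) (z : ℂ) : ℂ :=
  Complex.exp (-N * (z - (x₀ + r * Complex.I)) ^ 2)

theorem norm_barrier (x₀ r N : ℝ) (z : ℂ) :
    ‖barrier x₀ r N z‖ = Real.exp (N * ((r - z.im) ^ 2 - (z.re - x₀) ^ 2)) := by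
  rw [barrier, Complex.norm_exp]
  congr 1
  simp [pow_two]
  ring

theorem differentiable_barrier (x₀ r N : ℝ) : Differentiable ℂ (barrier x₀ r N) := by
  unfold barrier
  fun_prop

variable {N : ℝ}

theorem norm_barrier_le_of_im_eq_zero (hN : 0 ≤ N) (hz : z.im = 0) :
    ‖barrier x₀ r N z‖ ≤ Real.exp (N * r ^ 2) := by
  rw [norm_barrier, hz, sub_zero]
  gcongr
  exact sub_le_self _ (sq_nonneg _)

theorem norm_barrier_le_one (hN : 0 ≤ N) (hz : dist z x₀ = r) (hz0 : 0 ≤ z.im) :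
    ‖barrier x₀ r N z‖ ≤ 1 := by
  rw [norm_barrier, Real.exp_le_one_iff]
  have hsq := hz ▸ dist_ofReal_sq z x₀
  have hle : z.im ≤ r := abs_le_of_sq_le_sq' (by nlinarith [sq_nonneg (z.re - x₀)])
    (hz ▸ dist_nonneg) |>.2
  exact mul_nonpos_of_nonneg_of_nonpos hN (by nlinarith)

theorem exp_le_norm_barrier (hN : 0 ≤ N) (hz : dist z x₀ ≤ r / 8) :
    Real.exp (N * (r ^ 2 / 2)) ≤ ‖barrier x₀ r N z‖ := by
  have hr : 0 ≤ r / 8 := dist_nonneg.trans hz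
  have hsq : (z.re - x₀) ^ 2 + z.im ^ 2 ≤ (r / 8) ^ 2 :=
    dist_ofReal_sq z x₀ ▸ pow_le_pow_left₀ dist_nonneg hz 2
  have hle : z.im ≤ r / 8 := abs_le_of_sq_le_sq' (by nlinarith [sq_nonneg (z.re - x₀)]) hr |>.2
  rw [norm_barrier]
  gcongr
  nlinarith

theorem norm_le_of_norm_le_on_diameter {g : ℂ → ℂ} {M ε : ℝ} (hM0 : 0 ≤ M) (hε0 : 0 ≤ ε)
    (hg : DiffContOnCl ℂ g (upperHalfDisc x₀ r))
    (hM : ∀ z ∈ closure (upperHalfDisc x₀ r), ‖g z‖ ≤ M)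
    (hε : ∀ x : ℝ, (x : ℂ) ∈ closure (upperHalfDisc x₀ r) → ‖g x‖ ≤ ε) (hN : 0 ≤ N)
    (hz : z ∈ closure (upperHalfDisc x₀ (r / 8))) :
    ‖g z‖ ≤ Real.exp (N * (r ^ 2 / 2)) * ε + Real.exp (-(N * (r ^ 2 / 2))) * M := by
  have hzr := (mem_closure_upperHalfDisc hz).1
  have hr : r / 8 ≤ r := by linarith [dist_nonneg.trans hzr]
  have hfrontier : ∀ w ∈ frontier (upperHalfDisc x₀ r),
      ‖barrier x₀ r N w * g w‖ ≤ Real.exp (N * r ^ 2) * ε + M := by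
    intro w hw
    have hwcl := frontier_subset_closure hw
    rw [norm_mul]
    rcases mem_frontier_upperHalfDisc hw with him | hdist
    · have hgw : ‖g w‖ ≤ ε := by
        have hreal : w = (w.re : ℂ) := Complex.ext rfl him
        rw [hreal] at hwcl ⊢
        exact hε _ hwcl
      have hb := norm_barrier_le_of_im_eq_zero (x₀ := x₀) (r := r) hN him
      nlinarith [mul_le_mul hb hgw (norm_nonneg _) (Real.exp_pos _).le]
    · have hb := norm_barrier_le_one hN hdist (mem_closure_upperHalfDisc hwcl).2
      nlinarith [mul_le_mul hb (hM w hwcl) (norm_nonneg _) zero_le_one,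
        mul_nonneg (Real.exp_pos (N * r ^ 2)).le hε0]
  have hmax : ‖barrier x₀ r N z * g z‖ ≤ Real.exp (N * r ^ 2) * ε + M :=
    Complex.norm_le_of_forall_mem_frontier_norm_le (isBounded_ball.subset inter_subset_left)
      ((differentiable_barrier x₀ r N).diffContOnCl.smul hg) hfrontier
      (closure_mono (inter_subset_inter_left _ (ball_subset_ball hr)) hz)
  calc ‖g z‖ = Real.exp (-(N * (r ^ 2 / 2))) * (Real.exp (N * (r ^ 2 / 2)) * ‖g z‖) := by
        rw [← mul_assoc, ← Real.exp_add, neg_add_cancel, Real.exp_zero, one_mul]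
    _ ≤ Real.exp (-(N * (r ^ 2 / 2))) * (Real.exp (N * r ^ 2) * ε + M) := by
        gcongr
        refine (mul_le_mul_of_nonneg_right (exp_le_norm_barrier hN hzr) (norm_nonneg _)).trans ?_
        rwa [← norm_mul]
    _ = _ := by
        rw [mul_add, ← mul_assoc, ← Real.exp_add]
        ring_nf

theorem twoConstants_upperHalfDisc (x₀ : ℝ) (hr : 0 < r) :
    TwoConstants (upperHalfDisc x₀ r) (upperHalfDisc x₀ (r / 8)) := by
  intro M η hη
  have hlim : Tendsto (fun N : ℝ => Real.exp (-(N * (r ^ 2 / 2))) * max M 0) atTop (𝓝 0) := by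
    simpa [Function.comp_def] using (Real.tendsto_exp_neg_atTop_nhds_zero.comp
      (tendsto_id.atTop_mul_const (by positivity))).mul_const (max M 0)
  obtain ⟨N, hNη, hN⟩ :=
    ((hlim.eventually_le_const (half_pos hη)).and (eventually_ge_atTop 0)).exists
  refine ⟨η / 2 / Real.exp (N * (r ^ 2 / 2)), by positivity, fun g hg hM hε z hz => ?_⟩
  have h := norm_le_of_norm_le_on_diameter (le_max_right M 0) (by positivity) hg
    (fun w hw => (hM w hw).trans (le_max_left M 0)) hε hN hz
  rw [mul_div_cancel₀ _ (Real.exp_pos _).ne'] at h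
  linarith

theorem preimage_conj_upperHalfDisc (x₀ r : ℝ) :
    conj ⁻¹' upperHalfDisc x₀ r = lowerHalfDisc x₀ r := by
  ext z
  simp only [upperHalfDisc, lowerHalfDisc, mem_preimage, mem_inter_iff, mem_ball, mem_ofPred_eq,
    Complex.conj_im, neg_pos]
  rw [← Complex.dist_conj_conj, Complex.conj_conj, Complex.conj_ofReal]

end HalfDisc

/-- The sides `H` of the real line from which extensions are considered, namely the upper half
plane, the lower half plane and the whole plane, are treated simultaneously through the properties
listed here. -/
structure IsExtensionSide (H : Set ℂ) : Prop where
  isOpen : IsOpen H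
  convex : Convex ℝ H
  ofReal_mem_closure : ∀ x : ℝ, (x : ℂ) ∈ closure H
  twoConstants : ∀ (x₀ : ℝ) {r : ℝ}, 0 < r →
    TwoConstants (ball (x₀ : ℂ) r ∩ H) (ball (x₀ : ℂ) (r / 8) ∩ H)

theorem closure_ball_inter_of_convex {E : Type*} [NormedAddCommGroup E] [NormedSpace ℝ E]
    {H : Set E} (hH : Convex ℝ H) (hHo : IsOpen H) {x : E} (hx : x ∈ closure H) {r : ℝ}
    (hr : 0 < r) : closure (ball x r ∩ H) = closedBall x r ∩ closure H := by
  have hne : (ball x r ∩ H).Nonempty :=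
    mem_closure_iff.1 hx (ball x r) isOpen_ball (mem_ball_self hr)
  rw [closure_inter_of_convex (convex_ball x r) hH isOpen_ball hHo hne, closure_ball x hr.ne']

namespace IsExtensionSide

theorem upperHalfPlane : IsExtensionSide {z | 0 < z.im} where
  isOpen := isOpen_lt continuous_const Complex.continuous_im
  convex := convex_halfSpace_im_gt 0
  ofReal_mem_closure x := by simp [Complex.closure_setOfPred_lt_im]
  twoConstants x₀ _ hr := twoConstants_upperHalfDisc x₀ hr

theorem lowerHalfPlane : IsExtensionSide {z | z.im < 0} where
  isOpen := isOpen_lt Complex.continuous_im continuous_const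
  convex := convex_halfSpace_im_lt 0
  ofReal_mem_closure x := by simp [Complex.closure_setOfPred_im_lt]
  twoConstants x₀ r hr := by
    have h := (twoConstants_upperHalfDisc x₀ hr).preimage_conj
      (isOpen_ball.inter upperHalfPlane.isOpen)
    rwa [preimage_conj_upperHalfDisc, preimage_conj_upperHalfDisc] at h

theorem closure_ball_inter {H : Set ℂ} (hH : IsExtensionSide H) (x₀ : ℝ) {r : ℝ} (hr : 0 < r) :
    closure (ball (x₀ : ℂ) r ∩ H) = closedBall (x₀ : ℂ) r ∩ closure H :=
  closure_ball_inter_of_convex hH.convex hH.isOpen (hH.ofReal_mem_closure x₀) hr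

theorem ofReal_mem_closure_ball_inter {H : Set ℂ} (hH : IsExtensionSide H) {x x₀ r : ℝ}
    (hr : 0 < r) : (x : ℂ) ∈ closure (ball (x₀ : ℂ) r ∩ H) ↔ |x - x₀| ≤ r := by
  rw [hH.closure_ball_inter x₀ hr, mem_inter_iff, mem_closedBall, dist_ofReal_ofReal,
    and_iff_left (hH.ofReal_mem_closure x)]

theorem univ : IsExtensionSide univ where
  isOpen := isOpen_univ
  convex := convex_univ
  ofReal_mem_closure x := subset_closure (mem_univ _)
  twoConstants x₀ r hr := by
    refine (upperHalfPlane.twoConstants x₀ hr).of_closure_subset_union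
      (lowerHalfPlane.twoConstants x₀ hr) (inter_subset_inter_right _ (subset_univ _))
      (inter_subset_inter_right _ (subset_univ _)) ?_
    rw [upperHalfPlane.closure_ball_inter x₀ (by positivity),
      lowerHalfPlane.closure_ball_inter x₀ (by positivity), ← inter_union_distrib_left,
      Complex.closure_setOfPred_lt_im, Complex.closure_setOfPred_im_lt]
    exact fun z hz => ⟨closure_ball_subset_closedBall (closure_mono inter_subset_left hz),
      le_total 0 z.im⟩

theorem isPreconnected_ball_inter {H : Set ℂ} (hH : IsExtensionSide H) (x₀ : ℂ) (r : ℝ) :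
    IsPreconnected (ball x₀ r ∩ H) :=
  ((convex_ball x₀ r).inter hH.convex).isPreconnected

theorem eqOn_zero {H : Set ℂ} (hH : IsExtensionSide H) {f : ℂ → ℂ} {x₀ y r s : ℝ} (hs : 0 < s)
    (hsub : |y - x₀| + s ≤ r) (hf : DiffContOnCl ℂ f (ball (x₀ : ℂ) r ∩ H))
    (hf0 : ∀ x : ℝ, |x - y| ≤ s → f x = 0) :
    EqOn f 0 (closure (ball (x₀ : ℂ) r ∩ H)) := by
  have hball {t : ℝ} (ht : t ≤ s) : ball (y : ℂ) t ∩ H ⊆ ball (x₀ : ℂ) r ∩ H :=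
    inter_subset_inter_left H (ball_subset_ball' (by rw [dist_ofReal_ofReal]; linarith))
  have hsmall : EqOn f 0 (ball (y : ℂ) (s / 8) ∩ H) := ((hH.twoConstants y hs).eqOn_zero
    (isBounded_ball.subset inter_subset_left) (hf.mono (hball le_rfl))
    fun x hx => hf0 x ((hH.ofReal_mem_closure_ball_inter hs).1 hx)).mono subset_closure
  obtain ⟨z, hz⟩ : (ball (y : ℂ) (s / 8) ∩ H).Nonempty :=
    mem_closure_iff.1 (hH.ofReal_mem_closure y) _ isOpen_ball (mem_ball_self (by positivity))
  have hinside : EqOn f 0 (ball (x₀ : ℂ) r ∩ H) :=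
    (hf.differentiableOn.analyticOnNhd
      (isOpen_ball.inter hH.isOpen)).eqOn_zero_of_preconnected_of_eventuallyEq_zero
      (hH.isPreconnected_ball_inter x₀ r) (hball (by linarith) hz)
      (hsmall.eventuallyEq_of_mem ((isOpen_ball.inter hH.isOpen).mem_nhds hz))
  exact hinside.of_subset_closure hf.continuousOn continuousOn_const subset_closure le_rfl

end IsExtensionSide

section Extendable

variable {γ δ : ℝ}

/-- The continuous functions on `[γ, δ]` whose restriction to the real points of `closure Ω` extends
to a function that is continuous on `closure Ω` and holomorphic in `Ω`. -/
def extendable (γ δ : ℝ) (Ω : Set ℂ) : Submodule ℂ C(Icc γ δ, ℂ) where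
  carrier := {v | ∃ f : ℂ → ℂ, DiffContOnCl ℂ f Ω ∧
    ∀ x : Icc γ δ, ((x : ℝ) : ℂ) ∈ closure Ω → f (x : ℝ) = v x}
  add_mem' := by
    rintro v w ⟨f, hf, hfv⟩ ⟨g, hg, hgw⟩
    refine ⟨f + g, hf.add hg, fun x hx => ?_⟩
    rw [Pi.add_apply, hfv x hx, hgw x hx, ContinuousMap.add_apply]
  zero_mem' := ⟨0, diffContOnCl_const, fun _ _ => rfl⟩
  smul_mem' := by
    rintro c v ⟨f, hf, hfv⟩
    refine ⟨c • f, hf.const_smul c, fun x hx => ?_⟩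
    rw [Pi.smul_apply, hfv x hx, ContinuousMap.smul_apply]

/-- The functions in `extendable γ δ Ω` with an extension that is bounded by `M`. -/
def boundedExtendable (γ δ : ℝ) (Ω : Set ℂ) (M : ℝ) : Set C(Icc γ δ, ℂ) :=
  {v | ∃ f : ℂ → ℂ, DiffContOnCl ℂ f Ω ∧ (∀ z ∈ closure Ω, ‖f z‖ ≤ M) ∧
    ∀ x : Icc γ δ, ((x : ℝ) : ℂ) ∈ closure Ω → f (x : ℝ) = v x}

theorem mem_extendable {Ω : Set ℂ} {v : C(Icc γ δ, ℂ)} : v ∈ extendable γ δ Ω ↔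
    ∃ f : ℂ → ℂ, DiffContOnCl ℂ f Ω ∧
      ∀ x : Icc γ δ, ((x : ℝ) : ℂ) ∈ closure Ω → f (x : ℝ) = v x :=
  Iff.rfl

theorem iUnion_boundedExtendable {Ω : Set ℂ} (hΩ : Bornology.IsBounded Ω) :
    ⋃ M : ℕ, boundedExtendable γ δ Ω M = extendable γ δ Ω := by
  ext v
  rw [mem_iUnion]
  refine ⟨fun ⟨_, f, hf, _, hfv⟩ => ⟨f, hf, hfv⟩, fun ⟨f, hf, hfv⟩ => ?_⟩
  obtain ⟨M, hM⟩ := hΩ.isCompact_closure.exists_bound_of_continuousOn hf.continuousOn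
  exact ⟨⌈M⌉₊, f, hf, fun z hz => (hM z hz).trans (Nat.le_ceil M), hfv⟩

theorem closure_boundedExtendable_subset {Ω Ω' : Set ℂ} (h : TwoConstants Ω Ω') (hΩ' : IsOpen Ω')
    (hsub : Ω' ⊆ Ω) (hreal : ∀ x : ℝ, (x : ℂ) ∈ closure Ω → x ∈ Icc γ δ) (M : ℝ) :
    closure (boundedExtendable γ δ Ω M) ⊆ extendable γ δ Ω' := by
  intro w hw
  obtain ⟨v, hv, hvw⟩ := mem_closure_iff_seq_limit.1 hw
  choose F hF hFM hFv using hv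
  have hcauchy : UniformCauchySeqOn F atTop (closure Ω ∩ range ((↑) : ℝ → ℂ)) := by
    rw [Metric.uniformCauchySeqOn_iff]
    intro ε hε
    obtain ⟨N, hN⟩ := Metric.cauchySeq_iff.1 hvw.cauchySeq ε hε
    refine ⟨N, ?_⟩
    rintro m hm n hn _ ⟨hx, x, rfl⟩
    rw [hFv m ⟨x, hreal x hx⟩ hx, hFv n ⟨x, hreal x hx⟩ hx]
    exact (ContinuousMap.dist_apply_le_dist _).trans_lt (hN m hm n hn)
  obtain ⟨f, hf⟩ :=
    exists_tendstoUniformlyOn_of_uniformCauchySeqOn (h.uniformCauchySeqOn hF hFM hcauchy)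
  refine ⟨f, ⟨?_, hf.continuousOn (Frequently.of_forall fun n => ((hF n).mono hsub).continuousOn)⟩,
    fun x hx => ?_⟩
  · exact (hf.mono subset_closure).tendstoLocallyUniformlyOn.differentiableOn
      (Eventually.of_forall fun n => ((hF n).mono hsub).differentiableOn) hΩ'
  · have hlim : Tendsto (fun n => v n x) atTop (𝓝 (w x)) :=
      ((ContinuousEvalConst.continuous_eval_const x).tendsto w).comp hvw
    refine tendsto_nhds_unique (hf.tendsto_at hx) (hlim.congr fun n => ?_)
    exact (hFv n x (closure_mono hsub hx)).symm

theorem mem_Icc_of_abs_sub_le {x x₀ r : ℝ} (h₁ : γ ≤ x₀ - r) (h₂ : x₀ + r ≤ δ)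
    (hx : |x - x₀| ≤ r) : x ∈ Icc γ δ := by
  rw [abs_le] at hx
  constructor <;> linarith

theorem notMem_extendable_of_eq_zero_left {H : Set ℂ} (hH : IsExtensionSide H)
    {v : C(Icc γ δ, ℂ)} {x₀ r : ℝ} (hr : 0 < r) (h₁ : γ ≤ x₀ - r) (h₂ : x₀ + r ≤ δ)
    (hleft : ∀ x : Icc γ δ, (x : ℝ) ≤ x₀ → v x = 0)
    (hright : ∀ x : Icc γ δ, (x : ℝ) = x₀ + r → v x ≠ 0) :
    v ∉ extendable γ δ (ball (x₀ : ℂ) r ∩ H) := by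
  rintro ⟨f, hf, hfv⟩
  have hfv' (x : ℝ) (hx : |x - x₀| ≤ r) : f x = v ⟨x, mem_Icc_of_abs_sub_le h₁ h₂ hx⟩ :=
    hfv ⟨x, _⟩ ((hH.ofReal_mem_closure_ball_inter hr).2 hx)
  have hend : |x₀ + r - x₀| ≤ r := by rw [add_sub_cancel_left, abs_of_pos hr]
  have hf0 : EqOn f 0 (closure (ball (x₀ : ℂ) r ∩ H)) := by
    refine hH.eqOn_zero (y := x₀ - r / 2) (half_pos hr) ?_ hf fun x hx => ?_
    · rw [sub_sub_cancel_left, abs_neg, abs_of_pos (half_pos hr), add_halves]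
    · rw [abs_le] at hx
      rw [hfv' x (abs_le.2 ⟨by linarith, by linarith⟩)]
      exact hleft _ (by simp only; linarith)
  refine hright ⟨x₀ + r, mem_Icc_of_abs_sub_le h₁ h₂ hend⟩ rfl ?_
  rw [← hfv' (x₀ + r) hend]
  exact hf0 ((hH.ofReal_mem_closure_ball_inter hr).2 hend)

end Extendable

/-- The closed subintervals of `[γ, δ]` with rational centre and rational positive radius. They form
a countable family that is cofinal among the neighbourhoods of points of `[γ, δ]`. -/
structure RatInterval (γ δ : ℝ) where
  center : ℚ
  radius : ℚ
  radius_pos : (0 : ℝ) < radius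
  left_le : γ ≤ center - radius
  le_right : center + radius ≤ δ

namespace RatInterval

variable {γ δ : ℝ}

instance : Countable (RatInterval γ δ) :=
  Function.Injective.countable (f := fun j : RatInterval γ δ => (j.center, j.radius)) <| by
    rintro ⟨p, q, _⟩ ⟨p', q', _⟩ h
    simpa using h

/-- The open disc with a given interval as diameter. -/
def disc (j : RatInterval γ δ) : Set ℂ := ball ((j.center : ℝ) : ℂ) j.radius

/-- The concentric interval of one eighth of the radius, on which the two-constants estimate
holds. -/
def shrink (j : RatInterval γ δ) : RatInterval γ δ where
  center := j.center
  radius := j.radius / 8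
  radius_pos := by
    push_cast
    linarith [j.radius_pos]
  left_le := by
    push_cast
    linarith [j.radius_pos, j.left_le]
  le_right := by
    push_cast
    linarith [j.radius_pos, j.le_right]

theorem disc_shrink (j : RatInterval γ δ) :
    j.shrink.disc = ball ((j.center : ℝ) : ℂ) (j.radius / 8) := by
  simp [disc, shrink]

theorem isBounded_disc_inter (j : RatInterval γ δ) (H : Set ℂ) :
    Bornology.IsBounded (j.disc ∩ H) :=
  isBounded_ball.subset inter_subset_left

theorem center_mem_Icc (j : RatInterval γ δ) : (j.center : ℝ) ∈ Icc γ δ :=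
  ⟨by linarith [j.radius_pos, j.left_le], by linarith [j.radius_pos, j.le_right]⟩

theorem exists_closedBall_subset (h : γ < δ) {y s : ℝ} (hy : y ∈ Icc γ δ) (hs : 0 < s) :
    ∃ j : RatInterval γ δ, closedBall ((j.center : ℝ) : ℂ) j.radius ⊆ ball (y : ℂ) s := by
  have hab : max γ (y - s) < min δ (y + s) :=
    max_lt (lt_min h (by linarith [hy.1])) (lt_min (by linarith [hy.2]) (by linarith))
  obtain ⟨a, haγ, haδ⟩ := exists_rat_btwn hab
  obtain ⟨b, hab, hbδ⟩ := exists_rat_btwn haδ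
  rw [max_lt_iff] at haγ
  rw [lt_min_iff] at hbδ
  refine ⟨⟨(a + b) / 2, (b - a) / 2, ?_, ?_, ?_⟩, closedBall_subset_ball' ?_⟩
  any_goals push_cast; linarith
  rw [dist_ofReal_ofReal, add_comm, ← lt_sub_iff_add_lt, abs_lt]
  push_cast
  constructor <;> linarith

section Side

variable (j : RatInterval γ δ) {H : Set ℂ} (hH : IsExtensionSide H)

include hH

theorem closure_disc_inter :
    closure (j.disc ∩ H) = closedBall ((j.center : ℝ) : ℂ) j.radius ∩ closure H :=
  hH.closure_ball_inter _ j.radius_pos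

theorem mem_Icc_of_mem_closure {x : ℝ} (hx : (x : ℂ) ∈ closure (j.disc ∩ H)) : x ∈ Icc γ δ :=
  mem_Icc_of_abs_sub_le j.left_le j.le_right
    ((hH.ofReal_mem_closure_ball_inter j.radius_pos).1 hx)

theorem closure_boundedExtendable_subset_extendable_shrink (M : ℝ) :
    closure (boundedExtendable γ δ (j.disc ∩ H) M) ⊆ extendable γ δ (j.shrink.disc ∩ H) := by
  rw [disc_shrink]
  exact closure_boundedExtendable_subset (hH.twoConstants _ j.radius_pos)
    (isOpen_ball.inter hH.isOpen)
    (inter_subset_inter_left H (ball_subset_ball (by linarith [j.radius_pos])))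
    (fun x => j.mem_Icc_of_mem_closure hH) M

end Side

end RatInterval

section Germs

variable {γ δ : ℝ}

theorem isClosed_segmentC (γ δ : ℝ) : IsClosed (segmentC γ δ) :=
  (isCompact_Icc.image Complex.continuous_ofReal).isClosed

/-- The common form of `ExtendsAbove` and `ExtendsBelow`, for an arbitrary set `H` in place of a
half plane. -/
def ExtendsToSide (H : Set ℂ) (v : Icc γ δ → ℂ) (x₀ r : ℝ) : Prop :=
  ∃ f : ℂ → ℂ, ContinuousOn f (segmentC γ δ ∪ ball (x₀ : ℂ) r ∩ H) ∧
    DifferentiableOn ℂ f (ball (x₀ : ℂ) r ∩ H) ∧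
    ∀ x : Icc γ δ, ((x : ℝ) : ℂ) ∈ ball (x₀ : ℂ) r → f ((x : ℝ) : ℂ) = v x

theorem extendsToSide_of_mem_extendable (h : γ ≤ δ) {H : Set ℂ} {v : C(Icc γ δ, ℂ)} {x₀ r : ℝ}
    (hv : v ∈ extendable γ δ (ball (x₀ : ℂ) r ∩ H)) : ExtendsToSide H v x₀ r := by
  classical
  obtain ⟨f, hf, hfv⟩ := hv
  set F : ℂ → ℂ := (segmentC γ δ).piecewise (fun z => v (projIcc γ δ h z.re)) f with hF
  have hFv (x : Icc γ δ) : F (x : ℝ) = v x := by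
    have hx : ((x : ℝ) : ℂ) ∈ segmentC γ δ := ⟨x, x.2, rfl⟩
    rw [hF, piecewise_eq_of_mem _ _ _ hx, Complex.ofReal_re, projIcc_val]
  have hFf : EqOn F f (closure (ball (x₀ : ℂ) r ∩ H)) := by
    intro z hz
    by_cases hzs : z ∈ segmentC γ δ
    · obtain ⟨x, hx, rfl⟩ := hzs
      rw [hFv ⟨x, hx⟩, hfv ⟨x, hx⟩ hz]
    · exact piecewise_eq_of_notMem _ _ _ hzs
  have hFc : ContinuousOn F (segmentC γ δ ∪ closure (ball (x₀ : ℂ) r ∩ H)) := by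
    refine ContinuousOn.union_of_isClosed ?_ (hf.continuousOn.congr hFf) (isClosed_segmentC γ δ)
      isClosed_closure
    refine ContinuousOn.congr (Continuous.continuousOn ?_) (piecewise_eqOn _ _ _)
    exact v.continuous.comp (continuous_projIcc.comp Complex.continuous_re)
  exact ⟨F, hFc.mono (union_subset_union_right _ subset_closure),
    hf.differentiableOn.congr (hFf.mono subset_closure), fun x _ => hFv x⟩

theorem exists_extendsToSide_iff (h : γ < δ) {H : Set ℂ} (hH : IsExtensionSide H)
    (hreal : closure H ⊆ H ∪ range ((↑) : ℝ → ℂ)) {v : C(Icc γ δ, ℂ)} :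
    (∃ x₀ ∈ Icc γ δ, ∃ r > 0, ExtendsToSide H v x₀ r) ↔
      ∃ j : RatInterval γ δ, v ∈ extendable γ δ (j.disc ∩ H) := by
  constructor
  · rintro ⟨y, hy, s, hs, f, hfc, hfd, hfv⟩
    obtain ⟨j, hj⟩ := RatInterval.exists_closedBall_subset h hy hs
    have hcl : closure (j.disc ∩ H) ⊆ segmentC γ δ ∪ ball (y : ℂ) s ∩ H := by
      intro z hz
      have hzj := j.closure_disc_inter hH ▸ hz
      rcases hreal hzj.2 with hzH | ⟨x, rfl⟩
      · exact Or.inr ⟨hj hzj.1, hzH⟩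
      · exact Or.inl ⟨x, j.mem_Icc_of_mem_closure hH hz, rfl⟩
    refine ⟨j, f, ⟨hfd.mono ?_, hfc.mono hcl⟩, fun x hx => hfv x (hj ?_)⟩
    · exact inter_subset_inter_left H (ball_subset_closedBall.trans hj)
    · exact (j.closure_disc_inter hH ▸ hx).1
  · rintro ⟨j, hv⟩
    exact ⟨j.center, j.center_mem_Icc, j.radius, j.radius_pos,
      extendsToSide_of_mem_extendable h.le hv⟩

theorem exists_differentiableOn_ball_iff (h : γ < δ) {v : C(Icc γ δ, ℂ)} :
    (∃ x₀ ∈ Icc γ δ, ∃ r > 0, ∃ f : ℂ → ℂ, DifferentiableOn ℂ f (ball (x₀ : ℂ) r) ∧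
      ∀ x : Icc γ δ, ((x : ℝ) : ℂ) ∈ ball (x₀ : ℂ) r → f (x : ℝ) = v x) ↔
      ∃ j : RatInterval γ δ, v ∈ extendable γ δ (j.disc ∩ univ) := by
  simp only [inter_univ, mem_extendable]
  constructor
  · rintro ⟨y, hy, s, hs, f, hfd, hfv⟩
    obtain ⟨j, hj⟩ := RatInterval.exists_closedBall_subset h hy hs
    have hcl : closure j.disc ⊆ ball (y : ℂ) s := closure_ball_subset_closedBall.trans hj
    exact ⟨j, f, (hfd.mono hcl).diffContOnCl, fun x hx => hfv x (hcl hx)⟩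
  · rintro ⟨j, f, hf, hfv⟩
    exact ⟨j.center, j.center_mem_Icc, j.radius, j.radius_pos, f, hf.differentiableOn,
      fun x hx => hfv x (subset_closure hx)⟩

end Germs

section DerivativeChain

variable {𝕜 F : Type*} [NontriviallyNormedField 𝕜] [NormedAddCommGroup F] [NormedSpace 𝕜 F]
  {s : Set 𝕜} {k : ℕ∞} {w : ℕ → 𝕜 → F}

theorem eqOn_iteratedDerivWithin_of_hasDerivWithinAt (hs : UniqueDiffOn 𝕜 s)
    (hw : ∀ l : ℕ, (l : ℕ∞) < k → ∀ x ∈ s, HasDerivWithinAt (w l) (w (l + 1) x) s x)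
    {l : ℕ} (hl : (l : ℕ∞) ≤ k) : EqOn (iteratedDerivWithin l (w 0) s) (w l) s := by
  induction l with
  | zero => exact fun x _ => by rw [iteratedDerivWithin_zero]
  | succ l ih =>
    intro x hx
    have hlk : (l : ℕ∞) < k := lt_of_lt_of_le (by exact_mod_cast Nat.lt_succ_self l) hl
    rw [iteratedDerivWithin_succ, derivWithin_congr (ih hlk.le) (ih hlk.le hx)]
    exact (hw l hlk x hx).derivWithin (hs x hx)

theorem contDiffOn_of_hasDerivWithinAt (hs : UniqueDiffOn 𝕜 s)
    (hwc : ∀ l : ℕ, (l : ℕ∞) ≤ k → ContinuousOn (w l) s)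
    (hw : ∀ l : ℕ, (l : ℕ∞) < k → ∀ x ∈ s, HasDerivWithinAt (w l) (w (l + 1) x) s x) :
    ContDiffOn 𝕜 k (w 0) s := by
  have heq {l : ℕ} (hl : (l : ℕ∞) ≤ k) := eqOn_iteratedDerivWithin_of_hasDerivWithinAt hs hw hl
  exact contDiffOn_of_continuousOn_differentiableOn_deriv
    (fun l hl => (hwc l hl).congr (heq hl))
    fun l hl => DifferentiableOn.congr (fun x hx => (hw l hl x hx).differentiableWithinAt)
      (heq hl.le)

end DerivativeChain

theorem forall_hasDerivWithinAt_IccExtend_iff {F : Type*} [NormedAddCommGroup F] [NormedSpace ℝ F]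
    [CompleteSpace F] {a b : ℝ} (h : a ≤ b) (f g : C(Icc a b, F)) :
    (∀ x ∈ Icc a b, HasDerivWithinAt (IccExtend h f) (IccExtend h g x) (Icc a b) x) ↔
      ∀ x : Icc a b, f x = f ⟨a, left_mem_Icc.2 h⟩ + ∫ t in a..x, IccExtend h g t := by
  have hgc : Continuous (IccExtend h g) := g.continuous.Icc_extend'
  constructor
  · intro hfg x
    have hsub : Icc a (x : ℝ) ⊆ Icc a b := Icc_subset_Icc_right x.2.2
    rw [intervalIntegral.integral_eq_sub_of_hasDerivAt_of_le x.2.1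
      (f.continuous.Icc_extend' (h := h)).continuousOn (fun t ht => ?_)
      (hgc.intervalIntegrable _ _), IccExtend_val, IccExtend_left, add_sub_cancel]
    exact (hfg t (hsub (Ioo_subset_Icc_self ht))).hasDerivAt
      (Icc_mem_nhds ht.1 (ht.2.trans_le x.2.2))
  · intro hfg x hx
    refine (((hgc.integral_hasStrictDerivAt a x).hasDerivAt).const_add
      (f ⟨a, left_mem_Icc.2 h⟩)).hasDerivWithinAt.congr_of_mem (fun y hy => ?_) hx
    rw [IccExtend_of_mem h f hy]
    exact hfg ⟨y, hy⟩

namespace CkSpace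

variable {γ δ : ℝ} {h : γ < δ} {k : ℕ∞}

instance : IsTopologicalAddGroup (CkSpace h k) := (withSeminorms h k).topologicalAddGroup

instance : ContinuousSMul ℂ (CkSpace h k) := (withSeminorms h k).continuousSMul

/-- The derivatives of order `l ≤ k`, jointly. -/
def jet (h : γ < δ) (k : ℕ∞) : CkSpace h k →ₗ[ℂ] ({l : ℕ // (l : ℕ∞) ≤ k} → C(Icc γ δ, ℂ)) :=
  LinearMap.pi fun l => derivMap h k l l.2

theorem isInducing_jet : IsInducing (jet h k) := by
  have hjet := (jet h k).withSeminorms_induced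
    (withSeminorms_pi fun _ => norm_withSeminorms ℂ C(Icc γ δ, ℂ))
  obtain ⟨heq⟩ := WithSeminorms.congr_equiv (t := _) hjet (Equiv.sigmaUnique _ _).symm
  exact ⟨(withSeminorms h k).topology_eq_withSeminorms.trans heq.symm⟩

/-- The inclusion of `C^k([γ, δ])` into the continuous functions. -/
def toContinuousMap (h : γ < δ) (k : ℕ∞) : CkSpace h k →ₗ[ℂ] C(Icc γ δ, ℂ) :=
  derivMap h k 0 (by simp)

theorem continuous_toContinuousMap : Continuous (toContinuousMap h k) :=
  (continuous_apply (⟨0, by simp⟩ : {l : ℕ // (l : ℕ∞) ≤ k})).comp isInducing_jet.continuous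

theorem coe_toContinuousMap (u : CkSpace h k) : ⇑(toContinuousMap h k u) = u := by
  funext x
  change iteratedDerivWithin 0 (extendZero u) (Icc γ δ) x = u x
  rw [iteratedDerivWithin_zero, extendZero_coe]

theorem injective_jet : Function.Injective (jet h k) := by
  intro u v huv
  have h₀ : toContinuousMap h k u = toContinuousMap h k v := congrFun huv ⟨0, by simp⟩
  refine Subtype.ext ?_
  change (u : Icc γ δ → ℂ) = v
  rw [← coe_toContinuousMap, h₀, coe_toContinuousMap]

/-- The families of continuous functions, indexed by the orders `l ≤ k`, in which each function is
the derivative of the preceding one. -/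
def derivativeChains (h : γ < δ) (k : ℕ∞) : Set ({l : ℕ // (l : ℕ∞) ≤ k} → C(Icc γ δ, ℂ)) :=
  {v | ∀ i j : {l : ℕ // (l : ℕ∞) ≤ k}, (j : ℕ) = i + 1 → ∀ x ∈ Icc γ δ,
    HasDerivWithinAt (IccExtend h.le (v i)) (IccExtend h.le (v j) x) (Icc γ δ) x}

theorem isClosed_derivativeChains : IsClosed (derivativeChains h k) := by
  simp only [derivativeChains, forall_hasDerivWithinAt_IccExtend_iff h.le, ofPred_forall]
  refine isClosed_iInter fun i => isClosed_iInter fun j => isClosed_iInter fun _ =>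
    isClosed_iInter fun x => isClosed_eq (by fun_prop) (.add (by fun_prop) ?_)
  refine intervalIntegral.continuous_parametric_intervalIntegral_of_continuous' ?_ _ _
  exact ((continuous_apply _).comp continuous_fst).eval (continuous_projIcc.comp continuous_snd)

theorem jet_mem_derivativeChains (u : CkSpace h k) : jet h k u ∈ derivativeChains h k := by
  rintro i ⟨_, hj⟩ rfl x hx
  have hi : (i : ℕ∞) < k := (ENat.add_one_le_iff (ENat.natCast_ne_top _)).1 (mod_cast hj)
  have hjet (l) : EqOn (IccExtend h.le (jet h k u l))
      (iteratedDerivWithin l (extendZero u) (Icc γ δ)) (Icc γ δ) :=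
    fun y hy => IccExtend_of_mem h.le _ hy
  rw [hjet _ hx]
  refine HasDerivWithinAt.congr_of_mem ?_ (hjet i) hx
  rw [iteratedDerivWithin_succ]
  exact (u.contDiffOn.differentiableOn_iteratedDerivWithin (mod_cast hi) (uniqueDiffOn_Icc h) x
    hx).hasDerivWithinAt

theorem derivativeChains_subset_range_jet : derivativeChains h k ⊆ range (jet h k) := by
  intro v hv
  let w (l : ℕ) : ℝ → ℂ := if hl : (l : ℕ∞) ≤ k then IccExtend h.le (v ⟨l, hl⟩) else 0
  have hwv {l : ℕ} (hl : (l : ℕ∞) ≤ k) : w l = IccExtend h.le (v ⟨l, hl⟩) := dif_pos hl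
  have hwc (l : ℕ) (hl : (l : ℕ∞) ≤ k) : ContinuousOn (w l) (Icc γ δ) := by
    rw [hwv hl]
    exact (v ⟨l, hl⟩).continuous.Icc_extend'.continuousOn
  have hw (l : ℕ) (hl : (l : ℕ∞) < k) (x) (hx : x ∈ Icc γ δ) :
      HasDerivWithinAt (w l) (w (l + 1) x) (Icc γ δ) x := by
    have hl' : ((l + 1 : ℕ) : ℕ∞) ≤ k := mod_cast Order.add_one_le_of_lt hl
    rw [hwv hl.le, hwv hl']
    exact hv ⟨l, hl.le⟩ ⟨l + 1, hl'⟩ rfl x hx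
  let f : Icc γ δ → ℂ := v ⟨0, by simp⟩
  have hf : EqOn (extendZero f) (w 0) (Icc γ δ) := fun x hx => by
    rw [hwv (by simp), IccExtend_of_mem h.le _ hx]
    exact extendZero_coe f ⟨x, hx⟩
  have hs : UniqueDiffOn ℝ (Icc γ δ) := uniqueDiffOn_Icc h
  refine ⟨⟨f, (contDiffOn_of_hasDerivWithinAt hs hwc hw).congr hf⟩, ?_⟩
  funext l
  ext x
  calc iteratedDerivWithin l (extendZero f) (Icc γ δ) x
      = iteratedDerivWithin l (w 0) (Icc γ δ) x := iteratedDerivWithin_congr hf x.2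
    _ = w l x := eqOn_iteratedDerivWithin_of_hasDerivWithinAt hs hw l.2 x.2
    _ = v l x := by rw [hwv l.2, IccExtend_val]

theorem isClosedEmbedding_jet : IsClosedEmbedding (jet h k) where
  toIsInducing := isInducing_jet
  injective := injective_jet
  isClosed_range := by
    rw [(range_subset_iff.2 jet_mem_derivativeChains).antisymm derivativeChains_subset_range_jet]
    exact isClosed_derivativeChains

instance : BaireSpace (CkSpace h k) :=
  have := (isClosedEmbedding_jet (h := h) (k := k)).IsCompletelyMetrizableSpace
  inferInstance

/-- The restriction to `[γ, δ]` of a smooth function that vanishes exactly on `(-∞, x₀]`. -/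
def flat (h : γ < δ) (k : ℕ∞) (x₀ : ℝ) : CkSpace h k :=
  ⟨fun x => expNegInvGlue (x - x₀), by
    have hsmooth : ContDiffOn ℝ k (fun x : ℝ => (expNegInvGlue (x - x₀) : ℂ)) (Icc γ δ) :=
      (Complex.ofRealCLM.contDiff.comp
        (expNegInvGlue.contDiff.comp (contDiff_id.sub contDiff_const))).contDiffOn
    exact hsmooth.congr fun x hx => extendZero_coe _ ⟨x, hx⟩⟩

theorem flat_apply (x₀ : ℝ) (x : Icc γ δ) :
    flat h k x₀ x = (expNegInvGlue ((x : ℝ) - x₀) : ℂ) :=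
  rfl

end CkSpace

section Classes

variable {γ δ : ℝ} (h : γ < δ) (k : ℕ∞)

/-- The functions in `C^k([γ, δ])` that do not extend, from any subinterval of `[γ, δ]` with
rational centre and radius, to the part in `H` of the disc on this diameter. The classes `U₂`, `U₃`
and `U₅` arise from the two half planes and the whole plane. -/
def nowhereExtendable (H : Set ℂ) : Set (CkSpace h k) :=
  {u | ∀ j : RatInterval γ δ, CkSpace.toContinuousMap h k u ∉ extendable γ δ (j.disc ∩ H)}

theorem dense_and_isGδ_nowhereExtendable {H : Set ℂ} (hH : IsExtensionSide H) :
    Dense (nowhereExtendable h k H) ∧ IsGδ (nowhereExtendable h k H) := by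
  let ι := CkSpace.toContinuousMap h k
  let A (i : RatInterval γ δ × ℕ) : Set (CkSpace h k) :=
    ι ⁻¹' boundedExtendable γ δ (i.1.disc ∩ H) i.2
  let W (i : RatInterval γ δ × ℕ) : Submodule ℂ (CkSpace h k) :=
    (extendable γ δ (i.1.shrink.disc ∩ H)).comap ι
  have hA (j : RatInterval γ δ) :
      ⋃ M : ℕ, A (j, M) = ι ⁻¹' extendable γ δ (j.disc ∩ H) := by
    rw [← iUnion_boundedExtendable (j.isBounded_disc_inter H), preimage_iUnion]
  have hAW (i) : closure (A i) ⊆ W i :=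
    (CkSpace.continuous_toContinuousMap.closure_preimage_subset _).trans
      (preimage_mono (i.1.closure_boundedExtendable_subset_extendable_shrink hH i.2))
  have hWA (i) : (W i : Set (CkSpace h k)) ⊆ ⋃ i, A i := by
    rw [iUnion_prod']
    exact (hA i.1.shrink).superset.trans (subset_iUnion (fun j => ⋃ M, A (j, M)) i.1.shrink)
  have hW (i) : W i ≠ ⊤ := by
    let j := i.1.shrink
    suffices ι (CkSpace.flat h k j.center) ∉ extendable γ δ (j.disc ∩ H) from
      fun htop => this (htop ▸ Submodule.mem_top : CkSpace.flat h k j.center ∈ W i)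
    refine notMem_extendable_of_eq_zero_left hH j.radius_pos j.left_le j.le_right ?_ ?_ <;>
      intro x hx <;> rw [CkSpace.coe_toContinuousMap, CkSpace.flat_apply]
    · rw [expNegInvGlue.zero_of_nonpos (by linarith), Complex.ofReal_zero]
    · exact Complex.ofReal_ne_zero.2
        (expNegInvGlue.pos_of_pos (by rw [hx]; linarith [j.radius_pos])).ne'
  convert dense_and_isGδ_compl_iUnion_of_submodule hAW hWA hW using 2 <;>
  · simp only [iUnion_prod', hA, compl_iUnion]
    ext
    simp [nowhereExtendable, ι]

theorem classU2_eq : classU2 h k = nowhereExtendable h k {z | 0 < z.im} := by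
  ext u
  have hreal : closure {z : ℂ | 0 < z.im} ⊆ {z | 0 < z.im} ∪ range ((↑) : ℝ → ℂ) := by
    rw [Complex.closure_setOfPred_lt_im]
    exact fun z (hz : 0 ≤ z.im) => hz.lt_or_eq.imp_right fun (him : 0 = z.im) =>
      ⟨z.re, Complex.ext rfl him⟩
  have hiff := exists_extendsToSide_iff h IsExtensionSide.upperHalfPlane hreal
    (v := CkSpace.toContinuousMap h k u)
  rw [CkSpace.coe_toContinuousMap] at hiff
  exact (not_congr hiff).trans not_exists

theorem classU3_eq : classU3 h k = nowhereExtendable h k {z | z.im < 0} := by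
  ext u
  have hreal : closure {z : ℂ | z.im < 0} ⊆ {z | z.im < 0} ∪ range ((↑) : ℝ → ℂ) := by
    rw [Complex.closure_setOfPred_im_lt]
    exact fun z (hz : z.im ≤ 0) => hz.lt_or_eq.imp_right fun (him : z.im = 0) =>
      ⟨z.re, Complex.ext rfl him.symm⟩
  have hiff := exists_extendsToSide_iff h IsExtensionSide.lowerHalfPlane hreal
    (v := CkSpace.toContinuousMap h k u)
  rw [CkSpace.coe_toContinuousMap] at hiff
  exact (not_congr hiff).trans not_exists

theorem classU5_eq : classU5 h k = nowhereExtendable h k univ := by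
  ext u
  have hiff := exists_differentiableOn_ball_iff h (v := CkSpace.toContinuousMap h k u)
  rw [CkSpace.coe_toContinuousMap] at hiff
  exact (not_congr hiff).trans not_exists

end Classes

section RealAnalytic

variable {F : Type*} [NormedAddCommGroup F] [NormedSpace ℂ F]

/-- The power series over `ℂ` with the same coefficients as a given power series over `ℝ`. -/
def complexify (p : FormalMultilinearSeries ℝ ℝ F) : FormalMultilinearSeries ℂ ℂ F :=
  fun n => ContinuousMultilinearMap.mkPiRing ℂ (Fin n) (p.coeff n)

theorem radius_complexify (p : FormalMultilinearSeries ℝ ℝ F) :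
    (complexify p).radius = p.radius := by
  have hnorm (n : ℕ) : ‖complexify p n‖ = ‖p n‖ := by
    rw [complexify, ContinuousMultilinearMap.norm_mkPiRing, p.norm_apply_eq_norm_coef]
  simp only [FormalMultilinearSeries.radius, hnorm]

theorem sum_complexify (p : FormalMultilinearSeries ℝ ℝ F) (x : ℝ) :
    (complexify p).sum x = p.sum x := by
  refine tsum_congr fun n => ?_
  rw [complexify, ContinuousMultilinearMap.mkPiRing_apply, p.apply_eq_pow_smul_coeff,
    Finset.prod_const, Finset.card_fin, ← Complex.ofReal_pow, Complex.coe_smul]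

theorem analyticAt_real_iff_exists_analyticAt_complex [CompleteSpace F] {g : ℝ → F} {x₀ : ℝ} :
    AnalyticAt ℝ g x₀ ↔ ∃ f : ℂ → F, AnalyticAt ℂ f x₀ ∧ ∀ᶠ x : ℝ in 𝓝 x₀, f x = g x := by
  constructor
  · rintro ⟨p, r, hp⟩
    have hq := (complexify p).hasFPowerSeriesOnBall
      (radius_complexify p ▸ hp.r_pos.trans_le hp.r_le)
    refine ⟨fun z => (complexify p).sum (z - x₀), ?_, ?_⟩
    · simpa using (hq.comp_sub (x₀ : ℂ)).analyticAt
    · filter_upwards [Metric.eball_mem_nhds x₀ hp.r_pos] with x hx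
      rw [← Complex.ofReal_sub, sum_complexify, ← hp.sum (by simpa [edist_eq_enorm_sub] using hx),
        add_sub_cancel]
  · rintro ⟨f, hf, hfg⟩
    refine AnalyticAt.congr ?_ hfg
    exact (hf.restrictScalars (𝕜 := ℝ)).comp (f := fun x : ℝ => (x : ℂ))
      (Complex.ofRealCLM.analyticAt x₀)

theorem analyticWithinAt_extendZero_iff {γ δ : ℝ} {u : Icc γ δ → ℂ} {x₀ : ℝ} (hx₀ : x₀ ∈ Icc γ δ) :
    AnalyticWithinAt ℝ (extendZero u) (Icc γ δ) x₀ ↔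
      ∃ r > 0, ∃ f : ℂ → ℂ, DifferentiableOn ℂ f (ball (x₀ : ℂ) r) ∧
        ∀ x : Icc γ δ, ((x : ℝ) : ℂ) ∈ ball (x₀ : ℂ) r → f (x : ℝ) = u x := by
  rw [analyticWithinAt_iff_exists_analyticAt, insert_eq_of_mem hx₀]
  constructor
  · rintro ⟨g, hug, hg⟩
    obtain ⟨f, hf, hfg⟩ := analyticAt_real_iff_exists_analyticAt_complex.1 hg
    obtain ⟨r, hr, hfr⟩ := hf.exists_ball_analyticOnNhd
    have hev : ∀ᶠ x in 𝓝 x₀, x ∈ Icc γ δ → f x = extendZero u x := by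
      filter_upwards [hfg, eventually_nhdsWithin_iff.1 hug] with x hfx hux hx
      rw [hfx, hux hx]
    obtain ⟨ε, hε, hfu⟩ := Metric.eventually_nhds_iff.1 hev
    refine ⟨min r ε, lt_min hr hε, f,
      hfr.differentiableOn.mono (ball_subset_ball (min_le_left r ε)), fun x hx => ?_⟩
    rw [mem_ball, dist_ofReal_ofReal, lt_min_iff] at hx
    rw [hfu hx.2 x.2, extendZero_coe]
  · rintro ⟨r, hr, f, hfd, hfu⟩
    refine ⟨fun x => f x, ?_, analyticAt_real_iff_exists_analyticAt_complex.2
      ⟨f, hfd.analyticAt (ball_mem_nhds _ hr), EventuallyEq.rfl⟩⟩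
    filter_upwards [mem_nhdsWithin_of_mem_nhds (ball_mem_nhds x₀ hr), self_mem_nhdsWithin]
      with x hx hxI
    rw [hfu ⟨x, hxI⟩ (by rwa [mem_ball, dist_ofReal_ofReal])]
    exact extendZero_coe u ⟨x, hxI⟩

theorem nowhereAnalytic_eq_classU5 {γ δ : ℝ} (h : γ < δ) (k : ℕ∞) :
    nowhereAnalytic h k = classU5 h k := by
  ext u
  refine Iff.trans ?_ (not_exists.trans (forall_congr' fun _ => not_and)).symm
  exact forall₂_congr fun x₀ hx₀ => not_congr (analyticWithinAt_extendZero_iff hx₀)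

end RealAnalytic

theorem theorem4p13_general {γ δ : ℝ} (h : γ < δ) (k : ℕ∞) :
    ((Dense (classU2 h k) ∧ IsGδ (classU2 h k)) ∧
      (Dense (classU3 h k) ∧ IsGδ (classU3 h k)) ∧
      (Dense (classU4 h k) ∧ IsGδ (classU4 h k)) ∧
      (Dense (classU5 h k) ∧ IsGδ (classU5 h k))) ∧
    Dense (nowhereAnalytic h k) ∧ IsGδ (nowhereAnalytic h k) := by
  have h₂ : Dense (classU2 h k) ∧ IsGδ (classU2 h k) :=
    classU2_eq h k ▸ dense_and_isGδ_nowhereExtendable h k .upperHalfPlane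
  have h₃ : Dense (classU3 h k) ∧ IsGδ (classU3 h k) :=
    classU3_eq h k ▸ dense_and_isGδ_nowhereExtendable h k .lowerHalfPlane
  have h₄ : Dense (classU4 h k) ∧ IsGδ (classU4 h k) :=
    ⟨h₂.1.inter_of_Gδ h₂.2 h₃.2 h₃.1, h₂.2.inter h₃.2⟩
  have h₅ : Dense (classU5 h k) ∧ IsGδ (classU5 h k) :=
    classU5_eq h k ▸ dense_and_isGδ_nowhereExtendable h k .univ
  exact ⟨⟨h₂, h₃, h₄, h₅⟩, nowhereAnalytic_eq_classU5 h k ▸ h₅⟩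

end

theorem theorem4p13 :
    (∀ (γ δ : ℝ) (h : γ < δ) (k : ℕ∞),
      (Dense (classU2 h k) ∧ IsGδ (classU2 h k)) ∧
      (Dense (classU3 h k) ∧ IsGδ (classU3 h k)) ∧
      (Dense (classU4 h k) ∧ IsGδ (classU4 h k)) ∧
      (Dense (classU5 h k) ∧ IsGδ (classU5 h k))) ∧
    (Dense (nowhereAnalytic (zero_lt_one : (0 : ℝ) < 1) ⊤) ∧
      IsGδ (nowhereAnalytic (zero_lt_one : (0 : ℝ) < 1) ⊤)) :=
  ⟨fun _ _ h k => (theorem4p13_general h k).1, (theorem4p13_general zero_lt_one ⊤).2⟩
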